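/- Let $\mathbb F$ be $\mathbb R$ or $\mathbb C$, let $d\ge 0$, and for $k=1,\dots,d$ let $m_k, n_k, n_{Kk}\ge 0$ be integers. Set $\mathcal X=\bigoplus_{k=1}^d\mathbb F^{n_km_k}$ and $\mathcal X_K=\bigoplus_{k=1}^d\mathbb F^{n_{Kk}m_k}$. Define $$\boldsymbol\Delta=\{\operatorname{diag}(\Delta^0_1\otimes I_{n_1},\dots,\Delta^0_d\otimes I_{n_d}) : \Delta^0_k\in\mathbb F^{m_k\times m_k}\},$$ and, with the same $\Delta^0_k$ in both groups of blocks, $$\boldsymbol\Delta_{cl}=\{\operatorname{diag}(\Delta^0_1\otimes I_{n_1},\dots,\Delta^0_d\otimes I_{n_d},\ \Delta^0_1\otimes I_{n_{K1}},\dots,\Delta^0_d\otimes I_{n_{Kd}}) : \Delta^0_k\in\mathbb F^{m_k\times m_k}\},$$ where $\Delta^0\otimes I_n$ is the block matrix with blocks $\delta_{ij}I_n$. Let $\mathcal D_{\boldsymbol\Delta}$, $\mathcal D_{\boldsymbol\Delta_{cl}}$ be their commutants in $\mathcal L(\mathcal X)$ and $\mathcal L(\mathcal X\oplus\mathcal X_K)$.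 Let a plant be given by matrices $$\begin{bmatrix} A & B_1 & B_2\\ C_1& D_{11}& D_{12}\\ C_2& D_{21}& D_{22}\end{bmatrix}:\mathcal X\oplus\mathcal U_1\oplus\mathcal U_2\to\mathcal X\oplus\mathcal Y_1\oplus\mathcal Y_2,$$ with finite-dimensional $\mathcal U_i=\mathbb F^{r_i}$ and $\mathcal Y_i=\mathbb F^{s_i}$. A controller with dimension indices $n_{K1},\dots,n_{Kd}$ is a matrix $\begin{bmatrix}A_K&B_K\\C_K&D_K\end{bmatrix}:\mathcal X_K\oplus\mathcal Y_2\to\mathcal X_K\oplus\mathcal U_2$. The loop is well-posed if $I-D_{22}D_K$ is invertible (automatic if $D_{22}=0$). In that case the closed-loop state matrix on $\mathcal X\oplus\mathcal X_K$ is $$A_{cl}=\begin{bmatrix}A&0\\0&0\end{bmatrix}+\begin{bmatrix}0&B_2\\I&0\end{bmatrix}\left(I-\begin{bmatrix}A_K&B_K\\C_K&D_K\end{bmatrix}\begin{bmatrix}0&0\\0&D_{22}\end{bmatrix}\right)^{-1}\begin{bmatrix}A_K&B_K\\C_K&D_K\end{bmatrix}\begin{bmatrix}0&I\\C_2&0\end{bmatrix},$$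 which for $D_{22}=0$ is $\begin{bmatrix}A+B_2D_KC_2&B_2C_K\\B_KC_2&A_K\end{bmatrix}$. The closed-loop system is $\mathcal Q$-stable if there is an invertible $Q\in\mathcal D_{\boldsymbol\Delta_{cl}}$ with $\|Q^{-1}A_{cl}Q\|<1$ (operator norm induced by the Euclidean norm). Let $B_\perp$ and $C_\perp$ be matrices such that $B_\perp$ is injective with $\operatorname{Im}B_\perp=\operatorname{Ker}B_2^*$, and $C_\perp^*$ is injective with $\operatorname{Im}C_\perp^*=\operatorname{Ker}C_2$. **Theorem.** There exists a controller with the prescribed dimension indices $n_{K1},\dots,n_{Kd}$ for which the loop is well-posed and the closed-loop system is $\mathcal Q$-stable if and only if there exist positive-definite $X,Y\in\mathcal D_{\boldsymbol\Delta}$ such that $$B_\perp^*AYA^*B_\perp-B_\perp^*YB_\perp<0,\qquad C_\perp A^*XAC_\perp^*-C_\perp XC_\perp^*<0,$$ and such that $X=\operatorname{diag}(X_1,\dots,X_d)$, $Y=\operatorname{diag}(Y_1,\dots,Y_d)$ with $X_k=\operatorname{diag}(X_{k,0},\dots,X_{k,0})$, $Y_k=\operatorname{diag}(Y_{k,0},\dots,Y_{k,0})$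 ($m_k$ repeated blocks of size $n_k\times n_k$), where for every $k=1,\dots,d$ $$\begin{bmatrix}X_{k,0}&I\\I&Y_{k,0}\end{bmatrix}\ge0\quad\text{and}\quad\operatorname{rank}\begin{bmatrix}X_{k,0}&I\\I&Y_{k,0}\end{bmatrix}\le n_k+n_{Kk}.$$ -/

import Mathlib

namespace LFT

open scoped Kronecker

/-- Coordinates of the state space `⊕ₖ 𝔽^(nₖ·mₖ)`: the coordinate `⟨k, (i, a)⟩` is the `a`-th
entry of the `i`-th of the `mₖ` consecutive subblocks (each of size `nₖ`) of the `k`-th summand. -/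
abbrev StateIdx {d : ℕ} (m n : Fin d → ℕ) : Type :=
  Σ k : Fin d, Fin (m k) × Fin (n k)

/-- `diag(Δ⁰₁ ⊗ I_{n₁}, …, Δ⁰_d ⊗ I_{n_d})`. -/
def uncertainty {𝕜 : Type*} [RCLike 𝕜] {d : ℕ} {m : Fin d → ℕ} (n : Fin d → ℕ)
    (δ : ∀ k : Fin d, Matrix (Fin (m k)) (Fin (m k)) 𝕜) :
    Matrix (StateIdx m n) (StateIdx m n) 𝕜 :=
  Matrix.blockDiagonal' fun k => δ k ⊗ₖ (1 : Matrix (Fin (n k)) (Fin (n k)) 𝕜)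

/-- The uncertainty structure `𝚫`: all `diag(Δ⁰ₖ ⊗ I_{nₖ})`, the `Δ⁰ₖ` being arbitrary
`mₖ × mₖ` matrices. -/
def openStructure (𝕜 : Type*) [RCLike 𝕜] {d : ℕ} (m n : Fin d → ℕ) :
    Set (Matrix (StateIdx m n) (StateIdx m n) 𝕜) :=
  Set.range fun δ : (∀ k : Fin d, Matrix (Fin (m k)) (Fin (m k)) 𝕜) => uncertainty n δ

/-- The coupled closed-loop structure: the same `Δ⁰ₖ` act on the plant state with multiplicity
`nₖ` and on the controller state with multiplicity `n_{Kk}`. -/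
def closedLoopStructure (𝕜 : Type*) [RCLike 𝕜] {d : ℕ} (m n nK : Fin d → ℕ) :
    Set (Matrix (StateIdx m n ⊕ StateIdx m nK) (StateIdx m n ⊕ StateIdx m nK) 𝕜) :=
  Set.range fun δ : (∀ k : Fin d, Matrix (Fin (m k)) (Fin (m k)) 𝕜) =>
    Matrix.fromBlocks (uncertainty n δ) 0 0 (uncertainty nK δ)

/-- The commutant `𝒟_𝚫` of a set of matrices. -/
def commutant {𝕜 ι : Type*} [RCLike 𝕜] [Fintype ι] (S : Set (Matrix ι ι 𝕜)) :
    Set (Matrix ι ι 𝕜) :=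
  {X | ∀ D ∈ S, X * D = D * X}

/-- `𝒬`-stability of a state matrix `A` with respect to the structure `S`:
`‖Q⁻¹ A Q‖ < 1` for some invertible `Q` in the commutant of `S`, in the operator norm
induced by the Euclidean norm. -/
def IsQStable {𝕜 ι : Type*} [RCLike 𝕜] [Fintype ι] [DecidableEq ι] (S : Set (Matrix ι ι 𝕜))
    (A : Matrix ι ι 𝕜) : Prop :=
  ∃ Q ∈ commutant S, IsUnit Q ∧ ‖Matrix.toEuclideanCLM (n := ι) (𝕜 := 𝕜) (Q⁻¹ * A * Q)‖ < 1

/-- The system matrix of the plant: state space `⊕ₖ 𝔽^(nₖ·mₖ)`, disturbance and control inputs of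
dimensions `r₁`, `r₂`, error and measurement outputs of dimensions `s₁`, `s₂`. -/
structure Plant (𝕜 : Type*) {d : ℕ} (m n : Fin d → ℕ) (r₁ r₂ s₁ s₂ : ℕ) where
  A : Matrix (StateIdx m n) (StateIdx m n) 𝕜
  B₁ : Matrix (StateIdx m n) (Fin r₁) 𝕜
  B₂ : Matrix (StateIdx m n) (Fin r₂) 𝕜
  C₁ : Matrix (Fin s₁) (StateIdx m n) 𝕜
  C₂ : Matrix (Fin s₂) (StateIdx m n) 𝕜
  D₁₁ : Matrix (Fin s₁) (Fin r₁) 𝕜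
  D₁₂ : Matrix (Fin s₁) (Fin r₂) 𝕜
  D₂₁ : Matrix (Fin s₂) (Fin r₁) 𝕜
  D₂₂ : Matrix (Fin s₂) (Fin r₂) 𝕜

/-- The system matrix of a controller with state space `⊕ₖ 𝔽^(n_{Kk}·mₖ)`, from the measurements
(dimension `s₂`) to the controls (dimension `r₂`). -/
structure Controller (𝕜 : Type*) {d : ℕ} (m nK : Fin d → ℕ) (r₂ s₂ : ℕ) where
  A : Matrix (StateIdx m nK) (StateIdx m nK) 𝕜
  B : Matrix (StateIdx m nK) (Fin s₂) 𝕜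
  C : Matrix (Fin r₂) (StateIdx m nK) 𝕜
  D : Matrix (Fin r₂) (Fin s₂) 𝕜

/-- The lower linear fractional transformation `A + B (I - K D)⁻¹ K C`. -/
noncomputable def lowerLFT {𝕜 α ι γ κ : Type*} [RCLike 𝕜] [Fintype γ] [DecidableEq γ] [Fintype κ]
    (A : Matrix α ι 𝕜) (B : Matrix α γ 𝕜) (C : Matrix κ ι 𝕜) (D : Matrix κ γ 𝕜)
    (K : Matrix γ κ 𝕜) : Matrix α ι 𝕜 :=
  A + B * (1 - K * D)⁻¹ * K * C

section

variable {𝕜 : Type*} [RCLike 𝕜] {d : ℕ} {m n nK : Fin d → ℕ} {r₁ r₂ s₁ s₂ : ℕ}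

/-- The feedback loop is well-posed when `I - D₂₂ D_K` is invertible. -/
def WellPosed (P : Plant 𝕜 m n r₁ r₂ s₁ s₂) (K : Controller 𝕜 m nK r₂ s₂) : Prop :=
  IsUnit (1 - P.D₂₂ * K.D)

/-- The closed-loop system matrix
`[A_cl, B_cl; C_cl, D_cl]`, acting from `(x, x_K), u₁` to `(x, x_K), y₁`. -/
noncomputable def closedLoop (P : Plant 𝕜 m n r₁ r₂ s₁ s₂) (K : Controller 𝕜 m nK r₂ s₂) :
    Matrix ((StateIdx m n ⊕ StateIdx m nK) ⊕ Fin s₁)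
      ((StateIdx m n ⊕ StateIdx m nK) ⊕ Fin r₁) 𝕜 :=
  lowerLFT
    (Matrix.fromBlocks (Matrix.fromBlocks P.A 0 0 0) (Matrix.fromRows P.B₁ 0)
      (Matrix.fromCols P.C₁ 0) P.D₁₁)
    (Matrix.fromRows (Matrix.fromBlocks 0 P.B₂ 1 0) (Matrix.fromCols 0 P.D₁₂))
    (Matrix.fromCols (Matrix.fromBlocks 0 1 P.C₂ 0) (Matrix.fromRows 0 P.D₂₁))
    (Matrix.fromBlocks (0 : Matrix (StateIdx m nK) (StateIdx m nK) 𝕜) 0 0 P.D₂₂)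
    (Matrix.fromBlocks K.A K.B K.C K.D)

/-- The closed-loop state matrix `A_cl`. -/
noncomputable def closedLoopA (P : Plant 𝕜 m n r₁ r₂ s₁ s₂) (K : Controller 𝕜 m nK r₂ s₂) :
    Matrix (StateIdx m n ⊕ StateIdx m nK) (StateIdx m n ⊕ StateIdx m nK) 𝕜 :=
  (closedLoop P K).toBlocks₁₁

/-- The closed-loop system (with the coupled closed-loop structure) is `𝒬`-stable. -/
def ClosedLoopQStable (P : Plant 𝕜 m n r₁ r₂ s₁ s₂) (K : Controller 𝕜 m nK r₂ s₂) : Prop :=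
  IsQStable (closedLoopStructure 𝕜 m n nK) (closedLoopA P K)

/-- `diag(X₁, …, X_d)` where `Xₖ = diag(X_{k,0}, …, X_{k,0})` with `mₖ` repeated blocks. -/
def repeatedBlocks (m : Fin d → ℕ) (X₀ : ∀ k : Fin d, Matrix (Fin (n k)) (Fin (n k)) 𝕜) :
    Matrix (StateIdx m n) (StateIdx m n) 𝕜 :=
  Matrix.blockDiagonal' fun k => (1 : Matrix (Fin (m k)) (Fin (m k)) 𝕜) ⊗ₖ X₀ k

end

end LFT

open scoped ComplexOrder

/-! Eliminating the controller. The gain `K₀ = (1 - K D)⁻¹ K`, with `D = diag(0, D₂₂)`, enters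
`A_cl` affinely, so for a fixed scaling `Q` the task is to make `Q⁻¹ (A + B K₀ C) Q` a strict
contraction. By the strict Parrott lemma (`exists_strict_contraction`) some `K₀` does this iff the
scaled matrix contracts strictly on the kernel of the output factor and its adjoint does so on the
kernel of the adjoint input factor. The controller state is fully measured and actuated, so these
kernels are `Ker C₂ ⊕ 0` and `Ker B₂* ⊕ 0`. Only the plant corners `X` of `Q⁻* Q⁻¹` and `Y` of `Q
Q*` survive, and the conditions become the two LMIs (`exists_feedback_iff_lmi`).

It remains to see which pairs `(X, Y)` come from a `Q` in the closed-loop commutant. After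
regrouping the states, this commutant consists of the `diag(I ⊗ Rₖ)` with arbitrary `Rₖ` of size `nₖ
+ n_{Kk}` (`exists_eq_submatrix_blockRepeat`), so the question splits over `k`. In each block, `[X
I; I Y]` is the Gram matrix of the plant columns of `Rₖ⁻¹` and `Rₖ*`, which have `nₖ + n_{Kk}` rows;
hence positivity and the rank bound. Conversely, every Gram factorization with that many rows
extends to an invertible `Rₖ` (`coupling_iff_exists_completion`).

Well-posedness is then obtained by rescaling `K₀`: the norm bound is an open condition, and only
finitely many multiples of `K₀` are bad (`exists_wellPosed_iff`). -/

namespace LFT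

/-! ### Strict Parrott lemma for linear maps. -/

section Parrott

variable {𝕜 : Type*} [RCLike 𝕜]

/-- Every linear map over a field has a generalized inverse. -/
theorem exists_generalizedInverse {E F : Type*} [AddCommGroup E] [Module 𝕜 E]
    [AddCommGroup F] [Module 𝕜 F] (f : E →ₗ[𝕜] F) :
    ∃ g : F →ₗ[𝕜] E, ∀ x, f (g (f x)) = f x := by
  obtain ⟨s, hs⟩ := f.rangeRestrict.exists_rightInverse_of_surjective f.range_rangeRestrict
  obtain ⟨g, hg⟩ := LinearMap.exists_extend s
  refine ⟨g, fun x => ?_⟩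
  have h1 : g (f x) = s (f.rangeRestrict x) := by
    rw [← hg]; rfl
  have h2 := LinearMap.congr_fun hs (f.rangeRestrict x)
  rw [h1]
  exact congrArg Subtype.val h2

/-- A linear map that kills `ker V` and has its range in `range U` factors through both. -/
theorem exists_factor {E F G H : Type*} [AddCommGroup E] [Module 𝕜 E]
    [AddCommGroup F] [Module 𝕜 F] [AddCommGroup G] [Module 𝕜 G] [AddCommGroup H] [Module 𝕜 H]
    (D : E →ₗ[𝕜] F) (U : G →ₗ[𝕜] F) (V : E →ₗ[𝕜] H)
    (hU : ∀ x, D x ∈ LinearMap.range U) (hV : ∀ x, V x = 0 → D x = 0) :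
    ∃ K : H →ₗ[𝕜] G, ∀ x, U (K (V x)) = D x := by
  obtain ⟨U', hU'⟩ := exists_generalizedInverse U
  obtain ⟨V', hV'⟩ := exists_generalizedInverse V
  refine ⟨U' ∘ₗ D ∘ₗ V', fun x => ?_⟩
  have h1 : D (V' (V x)) = D x := by
    rw [← sub_eq_zero, ← map_sub]
    exact hV _ (by rw [map_sub, hV', sub_self])
  obtain ⟨g, hg⟩ := hU x
  simp only [LinearMap.comp_apply, h1]
  rw [← hg, hU']

variable {E F : Type*}
  [NormedAddCommGroup E] [InnerProductSpace 𝕜 E] [FiniteDimensional 𝕜 E]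
  [NormedAddCommGroup F] [InnerProductSpace 𝕜 F]

/-- Compactness of the unit sphere makes the norm attained; otherwise the pointwise bound would give
only `≤ 1`. -/
theorem opNorm_lt_one_iff (T : E →ₗ[𝕜] F) :
    ‖T.toContinuousLinearMap‖ < 1 ↔ ∀ x, x ≠ 0 → ‖T x‖ < ‖x‖ := by
  constructor
  · intro h x hx
    calc ‖T x‖ ≤ ‖T.toContinuousLinearMap‖ * ‖x‖ := T.toContinuousLinearMap.le_opNorm x
      _ < 1 * ‖x‖ := by gcongr
      _ = ‖x‖ := one_mul _
  · intro h
    have := FiniteDimensional.proper_rclike 𝕜 E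
    rcases subsingleton_or_nontrivial E with hE | hE
    · have : T.toContinuousLinearMap = 0 := by ext x; simp [Subsingleton.elim x 0]
      simp [this]
    · obtain ⟨x₁, hx₁⟩ := exists_ne (0 : E)
      have hne : (Metric.sphere (0 : E) 1).Nonempty := by
        refine ⟨((‖x₁‖⁻¹ : ℝ) : 𝕜) • x₁, ?_⟩
        simp [norm_smul, inv_mul_cancel₀ (norm_ne_zero_iff.mpr hx₁)]
      obtain ⟨x₀, hx₀, hmax⟩ := (isCompact_sphere (0 : E) 1).exists_isMaxOn hne
        (f := fun x => ‖T.toContinuousLinearMap x‖) (by fun_prop)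
      have hx₀' : ‖x₀‖ = 1 := by simpa using hx₀
      have hlt : ‖T x₀‖ < 1 := by
        have := h x₀ (by rintro rfl; simp at hx₀')
        rwa [hx₀'] at this
      refine lt_of_le_of_lt (ContinuousLinearMap.opNorm_le_bound _ (norm_nonneg (T x₀)) ?_) hlt
      intro x
      by_cases hx : x = 0
      · simp [hx]
      have hx' : ‖x‖ ≠ 0 := norm_ne_zero_iff.mpr hx
      have hy : ((‖x‖⁻¹ : ℝ) : 𝕜) • x ∈ Metric.sphere (0 : E) 1 := by
        simp [norm_smul, inv_mul_cancel₀ hx']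
      have := hmax hy
      simp only [Set.mem_ofPred_eq, map_smul, norm_smul, LinearMap.coe_toContinuousLinearMap',
        RCLike.norm_ofReal, abs_inv, abs_norm] at this
      rw [inv_mul_le_iff₀ (by positivity)] at this
      simpa [mul_comm] using this

variable [FiniteDimensional 𝕜 F]

/-- Strictness passes to the adjoint through the operator norm, which both maps share. -/
theorem norm_adjoint_lt_of_norm_lt (T : E →ₗ[𝕜] F) (h : ∀ x, x ≠ 0 → ‖T x‖ < ‖x‖) (y : F)
    (hy : y ≠ 0) : ‖LinearMap.adjoint T y‖ < ‖y‖ := by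
  have := FiniteDimensional.complete 𝕜 E
  have := FiniteDimensional.complete 𝕜 F
  have h1 := (opNorm_lt_one_iff T).mpr h
  revert y
  rw [← opNorm_lt_one_iff]
  have : (LinearMap.adjoint T).toContinuousLinearMap
      = ContinuousLinearMap.adjoint T.toContinuousLinearMap := by
    ext y
    refine ext_inner_left 𝕜 fun x => ?_
    rw [ContinuousLinearMap.adjoint_inner_right]
    exact LinearMap.adjoint_inner_right T x y
  rwa [this, LinearIsometryEquiv.norm_map]

variable {G H : Type*}
  [NormedAddCommGroup G] [InnerProductSpace 𝕜 G] [FiniteDimensional 𝕜 G]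
  [NormedAddCommGroup H] [InnerProductSpace 𝕜 H]

/-- **Strict Parrott lemma**: `M + U K V` can be made a strict contraction as soon as `M` is one
on `ker V` and `M*` is one on `ker U*`. -/
theorem exists_strict_contraction (M : E →ₗ[𝕜] F) (U : G →ₗ[𝕜] F) (V : E →ₗ[𝕜] H)
    (hU : ∀ y, LinearMap.adjoint U y = 0 → y ≠ 0 → ‖LinearMap.adjoint M y‖ < ‖y‖)
    (hV : ∀ x, V x = 0 → x ≠ 0 → ‖M x‖ < ‖x‖) :
    ∃ K : H →ₗ[𝕜] G, ∀ x, x ≠ 0 → ‖(M + U ∘ₗ K ∘ₗ V) x‖ < ‖x‖ := by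
  have := FiniteDimensional.complete 𝕜 E
  have := FiniteDimensional.complete 𝕜 F
  set L : Submodule 𝕜 F := LinearMap.ker (LinearMap.adjoint U) with hL
  set N : Submodule 𝕜 E := LinearMap.ker V with hN
  let r : F →ₗ[𝕜] F := L.starProjection.toLinearMap
  have hr_mem : ∀ y, r y ∈ L := fun y => L.starProjection_apply_mem y
  have hr_orth : ∀ y, y - r y ∈ Lᗮ := fun y => L.sub_starProjection_mem_orthogonal y
  have hr_pyth : ∀ y z : F, ‖r y + (z - r z)‖ ^ 2 = ‖r y‖ ^ 2 + ‖z - r z‖ ^ 2 := by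
    intro y z
    have := norm_add_sq_eq_norm_sq_add_norm_sq_of_inner_eq_zero (𝕜 := 𝕜) (r y) (z - r z)
      (Submodule.inner_right_of_mem_orthogonal (hr_mem y) (hr_orth z))
    simpa [sq] using this
  have hr_adj : LinearMap.adjoint r = r := by
    rw [eq_comm, LinearMap.eq_adjoint_iff]
    intro x y
    exact L.inner_starProjection_left_eq_right x y
  -- `r M` is a strict contraction
  have hrM : ∀ x, x ≠ 0 → ‖r (M x)‖ < ‖x‖ := by
    have h1 : ∀ y, y ≠ 0 → ‖(LinearMap.adjoint M ∘ₗ r) y‖ < ‖y‖ := by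
      intro y hy
      by_cases h0 : r y = 0
      · simpa [h0] using hy
      · exact (hU (r y) (hr_mem y) h0).trans_le (L.norm_starProjection_apply_le y)
    intro x hx
    have := norm_adjoint_lt_of_norm_lt _ h1 x hx
    rwa [LinearMap.adjoint_comp, hr_adj, LinearMap.adjoint_adjoint] at this
  -- `U K V` cannot alter the component `r M` of `M`. The form of `J` measures the slack `‖x‖² - ‖r
  -- M x‖²` that this component leaves.
  let J : E →ₗ[𝕜] E := LinearMap.id - LinearMap.adjoint (r ∘ₗ M) ∘ₗ (r ∘ₗ M)
  have hJ : ∀ x y, inner 𝕜 x (J y) = inner 𝕜 x y - inner 𝕜 (r (M x)) (r (M y)) := by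
    intro x y
    simp only [J, LinearMap.sub_apply, LinearMap.comp_apply, inner_sub_right, LinearMap.id_apply]
    rw [LinearMap.adjoint_inner_right]; rfl
  have hJre : ∀ x, RCLike.re (inner 𝕜 x (J x)) = ‖x‖ ^ 2 - ‖r (M x)‖ ^ 2 := by
    intro x
    rw [hJ, map_sub, inner_self_eq_norm_sq, inner_self_eq_norm_sq]
  have hJpos : ∀ x, x ≠ 0 → 0 < RCLike.re (inner 𝕜 x (J x)) := by
    intro x hx
    rw [hJre, sub_pos]
    exact pow_lt_pow_left₀ (hrM x hx) (norm_nonneg _) two_ne_zero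
  let a : E →ₗ[𝕜] N := LinearMap.adjoint N.subtype ∘ₗ J
  have ha : ∀ (x : N) y, inner 𝕜 x (a y) = inner 𝕜 (x : E) (J y) := by
    intro x y
    simp only [a, LinearMap.comp_apply, LinearMap.adjoint_inner_right, Submodule.subtype_apply]
  -- The compression of `J` to `N = ker V` is positive definite, hence invertible; this yields the
  -- `J`-orthogonal projection `z` onto `N`.
  have hinj : Function.Injective (a ∘ₗ N.subtype) := by
    rw [← LinearMap.ker_eq_bot, LinearMap.ker_eq_bot']
    intro x hx
    by_contra hne
    have h1 := hJpos x (by simpa using hne)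
    have h2 := ha x x
    rw [show a x = 0 from hx, inner_zero_right] at h2
    rw [← h2] at h1
    simp at h1
  let e := LinearEquiv.ofInjectiveEndo _ hinj
  let z : E →ₗ[𝕜] E := N.subtype ∘ₗ e.symm.toLinearMap ∘ₗ a
  have hz_mem : ∀ v, z v ∈ N := fun v => (e.symm (a v)).2
  have hz_a : ∀ v, a (z v) = a v := fun v => e.apply_symm_apply (a v)
  have hz_fix : ∀ v, V v = 0 → z v = v := by
    intro v hv
    have : e ⟨v, hv⟩ = a v := rfl
    simp only [z, LinearMap.comp_apply, ← this, LinearEquiv.coe_coe, LinearEquiv.symm_apply_apply,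
      Submodule.subtype_apply]
  have hz_orth : ∀ v, inner 𝕜 (z v) (J (v - z v)) = 0 := by
    intro v
    rw [← ha ⟨z v, hz_mem v⟩ (v - z v), map_sub, hz_a, sub_self, inner_zero_right]
  -- `K` replaces `(1 - r) M v` by `(1 - r) M (z v)`. The correction vanishes on `ker V`, where `z`
  -- is the identity, and lies in `Lᗮ = range U`.
  obtain ⟨K, hK⟩ := exists_factor ((LinearMap.id - r) ∘ₗ M ∘ₗ (z - LinearMap.id)) U V
    (by
      intro x
      have h1 : LinearMap.range U = Lᗮ := by
        rw [hL, LinearMap.orthogonal_ker, LinearMap.adjoint_adjoint]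
      rw [h1]
      exact hr_orth _)
    (by
      intro x hx
      simp [hz_fix x hx])
  refine ⟨K, fun v hv => ?_⟩
  have hT : (M + U ∘ₗ K ∘ₗ V) v = r (M v) + (M (z v) - r (M (z v))) := by
    have := hK v
    simp only [LinearMap.add_apply, LinearMap.comp_apply] at this ⊢
    rw [this]
    simp only [LinearMap.sub_apply, LinearMap.id_apply, map_sub]
    abel
  have hz_split : ‖M (z v)‖ ^ 2 = ‖r (M (z v))‖ ^ 2 + ‖M (z v) - r (M (z v))‖ ^ 2 := by
    rw [← hr_pyth, add_sub_cancel]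
  have hJsplit : RCLike.re (inner 𝕜 v (J v)) = RCLike.re (inner 𝕜 (z v) (J (z v)))
      + RCLike.re (inner 𝕜 (v - z v) (J (v - z v))) := by
    have h1 := hz_orth v
    have h2 : RCLike.re (inner 𝕜 (v - z v) (J (z v)))
        = RCLike.re (inner 𝕜 (z v) (J (v - z v))) := by
      rw [hJ, hJ, AddMonoidHom.map_sub, AddMonoidHom.map_sub,
        inner_re_symm (v - z v), inner_re_symm (r (M (v - z v)))]
    have h3 : inner 𝕜 v (J v) = inner 𝕜 (z v) (J (z v)) + inner 𝕜 (z v) (J (v - z v))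
        + inner 𝕜 (v - z v) (J (z v)) + inner 𝕜 (v - z v) (J (v - z v)) := by
      conv_lhs => rw [← add_sub_cancel (z v) v]
      simp only [map_add, inner_add_left, inner_add_right]
      ring
    rw [h3, map_add, map_add, map_add, h2, h1]
    simp
  rw [hJre, hJre] at hJsplit
  refine lt_of_pow_lt_pow_left₀ 2 (norm_nonneg _) ?_
  rw [hT, hr_pyth]
  -- If `z v ≠ 0`, strictness comes from `M` on `ker V`; if `z v = 0`, only `r M v` is left and
  -- strictness comes from `J > 0`.
  by_cases hz0 : z v = 0
  · have h4 := hJpos v hv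
    rw [hJre] at h4
    simp only [hz0, map_zero, sub_zero, norm_zero] at *
    linarith
  · have h4 := hV (z v) (hz_mem v) hz0
    have h5 : ‖M (z v)‖ ^ 2 < ‖z v‖ ^ 2 := pow_lt_pow_left₀ h4 (norm_nonneg _) two_ne_zero
    have h6 : 0 ≤ RCLike.re (inner 𝕜 (v - z v) (J (v - z v))) := by
      by_cases h : v - z v = 0
      · rw [h]; simp
      · exact (hJpos _ h).le
    linarith

end Parrott

end LFT

namespace LFT

open Matrix

/-! ### Linear matrix inequalities for a fixed scaling. -/

section MatrixParrott

variable {𝕜 : Type*} [RCLike 𝕜]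

theorem norm_toEuclideanCLM_lt_one_iff {ι : Type*} [Fintype ι] [DecidableEq ι]
    (T : Matrix ι ι 𝕜) :
    ‖toEuclideanCLM (n := ι) (𝕜 := 𝕜) T‖ < 1 ↔
      ∀ x : ι → 𝕜, x ≠ 0 → ‖WithLp.toLp 2 (T *ᵥ x)‖ < ‖WithLp.toLp 2 x‖ := by
  have h := opNorm_lt_one_iff (toEuclideanLin T)
  constructor
  · intro hT x hx
    exact h.mp hT (WithLp.toLp 2 x) (by simpa using hx)
  · intro hT
    exact h.mpr fun x hx => hT x.ofLp (by simpa using hx)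

theorem norm_toEuclideanCLM_conjTranspose {ι : Type*} [Fintype ι] [DecidableEq ι]
    (T : Matrix ι ι 𝕜) :
    ‖toEuclideanCLM (n := ι) (𝕜 := 𝕜) Tᴴ‖ = ‖toEuclideanCLM (n := ι) (𝕜 := 𝕜) T‖ := by
  rw [← star_eq_conjTranspose, map_star, ContinuousLinearMap.star_eq_adjoint,
    LinearIsometryEquiv.norm_map]

/-- The solvability criterion for the scaled feedback problem `‖Q⁻¹ (A + B K C) Q‖ < 1`. -/
theorem exists_feedback_iff {ι γ κ : Type*} [Fintype ι] [DecidableEq ι] [Fintype γ]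
    [DecidableEq γ] [Fintype κ] [DecidableEq κ] (A : Matrix ι ι 𝕜) (B : Matrix ι γ 𝕜)
    (C : Matrix κ ι 𝕜) {R S : Matrix ι ι 𝕜} (hRS : R * S = 1) :
    (∃ K : Matrix γ κ 𝕜, ‖toEuclideanCLM (n := ι) (𝕜 := 𝕜) (S * (A + B * K * C) * R)‖ < 1) ↔
      (∀ ξ : ι → 𝕜, Bᴴ *ᵥ ξ = 0 → ξ ≠ 0 →
        ‖WithLp.toLp 2 (Rᴴ *ᵥ (Aᴴ *ᵥ ξ))‖ < ‖WithLp.toLp 2 (Rᴴ *ᵥ ξ)‖) ∧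
      (∀ ξ : ι → 𝕜, C *ᵥ ξ = 0 → ξ ≠ 0 →
        ‖WithLp.toLp 2 (S *ᵥ (A *ᵥ ξ))‖ < ‖WithLp.toLp 2 (S *ᵥ ξ)‖) := by
  have hSR : S * R = 1 := mul_eq_one_comm.mp hRS
  have hRS' : Rᴴ * Sᴴ = 1 := by rw [← conjTranspose_mul, hSR, conjTranspose_one]
  have hSR' : Sᴴ * Rᴴ = 1 := by rw [← conjTranspose_mul, hRS, conjTranspose_one]
  constructor
  · rintro ⟨K, hK⟩
    constructor
    · intro ξ hξ hξ0
      rw [← norm_toEuclideanCLM_conjTranspose, norm_toEuclideanCLM_lt_one_iff] at hK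
      have h1 := hK (Rᴴ *ᵥ ξ) (by
        intro h0
        apply hξ0
        rw [← one_mulVec ξ, ← hSR', ← mulVec_mulVec, h0, mulVec_zero])
      convert h1 using 3
      simp only [conjTranspose_mul, conjTranspose_add, ← mulVec_mulVec, add_mulVec]
      rw [mulVec_mulVec _ Sᴴ, hSR', one_mulVec, hξ]
      simp
    · intro ξ hξ hξ0
      rw [norm_toEuclideanCLM_lt_one_iff] at hK
      have h1 := hK (S *ᵥ ξ) (by
        intro h0
        apply hξ0
        rw [← one_mulVec ξ, ← hRS, ← mulVec_mulVec, h0, mulVec_zero])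
      convert h1 using 3
      simp only [← mulVec_mulVec, add_mulVec]
      rw [mulVec_mulVec _ R, hRS, one_mulVec, hξ]
      simp
  · rintro ⟨h1, h2⟩
    -- Expand `S (A + B K C) R = S A R + (S B) K (C R)`. The substitutions `ξ = Sᴴ y` and `ξ = R y`
    -- carry the kernels of `(S B)ᴴ` and `C R` to those of `Bᴴ` and `C`.
    obtain ⟨K, hK⟩ := exists_strict_contraction (𝕜 := 𝕜) (toEuclideanLin (S * A * R))
      (toEuclideanLin (S * B)) (toEuclideanLin (C * R))
      (by
        rw [← toEuclideanLin_conjTranspose_eq_adjoint, ← toEuclideanLin_conjTranspose_eq_adjoint]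
        intro y hy hy0
        have hy' : Bᴴ *ᵥ (Sᴴ *ᵥ y.ofLp) = 0 := by
          have := congrArg WithLp.ofLp hy
          simpa [conjTranspose_mul, mulVec_mulVec] using this
        have h3 := h1 _ hy' (by
          intro h0
          apply hy0
          have : y.ofLp = 0 := by
            rw [← one_mulVec y.ofLp, ← hRS', ← mulVec_mulVec, h0, mulVec_zero]
          simpa using this)
        rw [mulVec_mulVec _ Rᴴ Sᴴ, hRS', one_mulVec] at h3
        convert h3 using 2
        · rfl
        simp [toLpLin_apply, conjTranspose_mul, mulVec_mulVec, Matrix.mul_assoc])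
      (by
        intro y hy hy0
        have hy' : C *ᵥ (R *ᵥ y.ofLp) = 0 := by
          have := congrArg WithLp.ofLp hy
          simpa [mulVec_mulVec] using this
        have h3 := h2 _ hy' (by
          intro h0
          apply hy0
          have : y.ofLp = 0 := by
            rw [← one_mulVec y.ofLp, ← hSR, ← mulVec_mulVec, h0, mulVec_zero]
          simpa using this)
        rw [mulVec_mulVec _ S R, hSR, one_mulVec] at h3
        convert h3 using 2
        · rfl
        simp [toLpLin_apply, mulVec_mulVec, Matrix.mul_assoc])
    refine ⟨toEuclideanLin.symm K, ?_⟩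
    rw [norm_toEuclideanCLM_lt_one_iff]
    intro x hx
    have h3 := hK (WithLp.toLp 2 x) (by simpa using hx)
    convert h3 using 2
    · rfl
    have hKx : ∀ v, K v = WithLp.toLp 2 (toEuclideanLin.symm K *ᵥ v.ofLp) := by
      intro v
      conv_lhs => rw [← toEuclideanLin.apply_symm_apply K]
      rfl
    simp only [LinearMap.add_apply, LinearMap.comp_apply, hKx, toLpLin_apply, Matrix.mul_add,
      Matrix.add_mul, add_mulVec, mulVec_mulVec, Matrix.mul_assoc, WithLp.toLp_add]

theorem star_dotProduct_gram {ι κ : Type*} [Fintype ι] [Fintype κ] (G : Matrix κ ι 𝕜)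
    (x : ι → 𝕜) :
    star x ⬝ᵥ ((Gᴴ * G) *ᵥ x) = ((‖WithLp.toLp 2 (G *ᵥ x)‖ ^ 2 : ℝ) : 𝕜) := by
  rw [← mulVec_mulVec, dotProduct_mulVec, ← star_mulVec, dotProduct_comm,
    ← EuclideanSpace.inner_toLp_toLp, inner_self_eq_norm_sq_to_K]
  simp

/-- The bridge between the LMIs and the norm inequalities of the Parrott criterion. -/
theorem posDef_gram_sub_gram_iff {ι κ : Type*} [Fintype ι] [Fintype κ] (G₁ G₂ : Matrix κ ι 𝕜) :
    (G₁ᴴ * G₁ - G₂ᴴ * G₂).PosDef ↔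
      ∀ x : ι → 𝕜, x ≠ 0 → ‖WithLp.toLp 2 (G₂ *ᵥ x)‖ < ‖WithLp.toLp 2 (G₁ *ᵥ x)‖ := by
  have key : ∀ x : ι → 𝕜, 0 < star x ⬝ᵥ ((G₁ᴴ * G₁ - G₂ᴴ * G₂) *ᵥ x) ↔
      ‖WithLp.toLp 2 (G₂ *ᵥ x)‖ < ‖WithLp.toLp 2 (G₁ *ᵥ x)‖ := by
    intro x
    rw [sub_mulVec, dotProduct_sub, star_dotProduct_gram, star_dotProduct_gram, sub_pos,
      RCLike.ofReal_lt_ofReal]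
    exact pow_lt_pow_iff_left₀ (norm_nonneg _) (norm_nonneg _) two_ne_zero
  rw [posDef_iff_dotProduct_mulVec]
  constructor
  · rintro ⟨-, h⟩ x hx
    exact (key x).mp (h hx)
  · intro h
    exact ⟨(isHermitian_conjTranspose_mul_self _).sub (isHermitian_conjTranspose_mul_self _),
      fun x hx => (key x).mpr (h x hx)⟩

/-- A quantified statement over the kernel of `T` is one over the coordinates given by an injective
`N` that parametrizes this kernel. -/
theorem forall_ker_iff {α κ ρ : Type*} [Fintype α] [Fintype ρ] {N : Matrix α ρ 𝕜}
    {T : Matrix κ α 𝕜} (hinj : Function.Injective N.mulVecLin)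
    (hrange : LinearMap.range N.mulVecLin = LinearMap.ker T.mulVecLin) (p : (α → 𝕜) → Prop) :
    (∀ x : α → 𝕜, T *ᵥ x = 0 → x ≠ 0 → p x) ↔ ∀ η : ρ → 𝕜, η ≠ 0 → p (N *ᵥ η) := by
  constructor
  · intro h η hη
    refine h _ ?_ fun h0 => hη (hinj (by simpa using h0))
    have : N.mulVecLin η ∈ LinearMap.ker T.mulVecLin := hrange ▸ LinearMap.mem_range_self _ _
    simpa using this
  · intro h x hx hx0
    have : x ∈ LinearMap.range N.mulVecLin := by rw [hrange]; simpa using hx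
    obtain ⟨η, rfl⟩ := this
    exact h η (by rintro rfl; simp at hx0)

/-- The identity block forces the controller component to vanish. The conjugate transpose of the
input factor has the same shape, so this serves both conditions. -/
theorem forall_ker_fromBlocks_iff {α β κ : Type*} [Fintype α] [Fintype β] [DecidableEq β]
    (C : Matrix κ α 𝕜) (p : (α ⊕ β → 𝕜) → Prop) :
    (∀ ξ, fromBlocks (0 : Matrix β α 𝕜) (1 : Matrix β β 𝕜) C (0 : Matrix κ β 𝕜) *ᵥ ξ = 0 →
      ξ ≠ 0 → p ξ) ↔
      ∀ x : α → 𝕜, C *ᵥ x = 0 → x ≠ 0 → p (Sum.elim x 0) := by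
  constructor
  · intro h x hx hx0
    refine h _ ?_ fun h0 => hx0 ?_
    · rw [fromBlocks_mulVec]
      ext (i | i) <;> simp [Function.comp_def] ; simpa using congrFun hx i
    · ext i
      exact congrFun h0 (Sum.inl i)
  · intro h ξ hξ hξ0
    rw [fromBlocks_mulVec] at hξ
    have h2 : ξ ∘ Sum.inr = 0 := by
      ext i
      simpa using congrFun hξ (Sum.inl i)
    have h1 : C *ᵥ (ξ ∘ Sum.inl) = 0 := by
      ext i
      simpa using congrFun hξ (Sum.inr i)
    have h3 : ξ = Sum.elim (ξ ∘ Sum.inl) 0 := by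
      rw [← h2, Sum.elim_comp_inl_inr]
    rw [h3]
    refine h _ h1 fun h0 => hξ0 ?_
    rw [h3, h0]
    ext (i | i) <;> rfl

theorem mulVec_sumElim_zero {α β κ : Type*} [Fintype α] [Fintype β] (S : Matrix κ (α ⊕ β) 𝕜)
    (x : α → 𝕜) : S *ᵥ Sum.elim x 0 = S.submatrix id Sum.inl *ᵥ x := by
  ext i
  simp [mulVec, dotProduct]

/-- The closed-loop state matrix as an affine function of the gain `K`, for a plant without
feedthrough whose state is extended by the controller state. -/
def feedback {α β γ κ : Type*} [Fintype β] [DecidableEq β] [Fintype γ] [Fintype κ]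
    (A : Matrix α α 𝕜) (B : Matrix α γ 𝕜) (C : Matrix κ α 𝕜) (K : Matrix (β ⊕ γ) (β ⊕ κ) 𝕜) :
    Matrix (α ⊕ β) (α ⊕ β) 𝕜 :=
  (fromBlocks A 0 0 0 : Matrix (α ⊕ β) (α ⊕ β) 𝕜) +
    (fromBlocks 0 B 1 0 : Matrix (α ⊕ β) (β ⊕ γ) 𝕜) * K *
      (fromBlocks 0 1 C 0 : Matrix (β ⊕ κ) (α ⊕ β) 𝕜)

/-- On vectors `(x, 0)` the scalings act through the first block columns of `S` and `Rᴴ`, whose Gram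
matrices are `X` and `Y`. -/
theorem exists_feedback_iff_lmi {α β γ κ ρ σ : Type*} [Fintype α] [DecidableEq α] [Fintype β]
    [DecidableEq β] [Fintype γ] [DecidableEq γ] [Fintype κ] [DecidableEq κ] [Fintype ρ]
    [Fintype σ] (A : Matrix α α 𝕜) (B : Matrix α γ 𝕜) (C : Matrix κ α 𝕜)
    (Bp : Matrix α ρ 𝕜) (Cp : Matrix σ α 𝕜)
    (hB_inj : Function.Injective Bp.mulVecLin)
    (hB_range : LinearMap.range Bp.mulVecLin = LinearMap.ker Bᴴ.mulVecLin)
    (hC_inj : Function.Injective Cpᴴ.mulVecLin)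
    (hC_range : LinearMap.range Cpᴴ.mulVecLin = LinearMap.ker C.mulVecLin)
    {R S : Matrix (α ⊕ β) (α ⊕ β) 𝕜} (hRS : R * S = 1) {X Y : Matrix α α 𝕜}
    (hX : X = (Sᴴ * S).toBlocks₁₁) (hY : Y = (R * Rᴴ).toBlocks₁₁) :
    (∃ K : Matrix (β ⊕ γ) (β ⊕ κ) 𝕜,
      ‖toEuclideanCLM (n := α ⊕ β) (𝕜 := 𝕜) (S * feedback A B C K * R)‖ < 1) ↔
      (-(Bpᴴ * A * Y * Aᴴ * Bp - Bpᴴ * Y * Bp)).PosDef ∧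
      (-(Cp * Aᴴ * X * A * Cpᴴ - Cp * X * Cpᴴ)).PosDef := by
  have hX' : X = (S.submatrix id Sum.inl)ᴴ * S.submatrix id Sum.inl := by
    rw [hX]; rfl
  have hY' : Y = (Rᴴ.submatrix id Sum.inl)ᴴ * Rᴴ.submatrix id Sum.inl := by
    rw [hY]
    ext i j
    simp [mul_apply, toBlocks₁₁]
  have e1 : -(Bpᴴ * A * Y * Aᴴ * Bp - Bpᴴ * Y * Bp)
      = (Rᴴ.submatrix id Sum.inl * Bp)ᴴ * (Rᴴ.submatrix id Sum.inl * Bp)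
        - (Rᴴ.submatrix id Sum.inl * Aᴴ * Bp)ᴴ * (Rᴴ.submatrix id Sum.inl * Aᴴ * Bp) := by
    rw [neg_sub, hY']
    simp only [conjTranspose_mul, conjTranspose_conjTranspose, Matrix.mul_assoc]
  have e2 : -(Cp * Aᴴ * X * A * Cpᴴ - Cp * X * Cpᴴ)
      = (S.submatrix id Sum.inl * Cpᴴ)ᴴ * (S.submatrix id Sum.inl * Cpᴴ)
        - (S.submatrix id Sum.inl * A * Cpᴴ)ᴴ * (S.submatrix id Sum.inl * A * Cpᴴ) := by
    rw [neg_sub, hX']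
    simp only [conjTranspose_mul, conjTranspose_conjTranspose, Matrix.mul_assoc]
  have hA : ∀ (M : Matrix α α 𝕜) (x : α → 𝕜),
      fromBlocks M (0 : Matrix α β 𝕜) (0 : Matrix β α 𝕜) (0 : Matrix β β 𝕜) *ᵥ Sum.elim x 0
        = Sum.elim (M *ᵥ x) 0 := by
    intro M x
    rw [fromBlocks_mulVec]
    simp
  simp only [feedback]
  rw [exists_feedback_iff _ _ _ hRS, e1, e2, posDef_gram_sub_gram_iff, posDef_gram_sub_gram_iff,
    fromBlocks_conjTranspose, fromBlocks_conjTranspose]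
  simp only [conjTranspose_zero, conjTranspose_one]
  rw [forall_ker_fromBlocks_iff, forall_ker_fromBlocks_iff]
  simp only [hA, mulVec_sumElim_zero]
  rw [forall_ker_iff hB_inj hB_range, forall_ker_iff hC_inj hC_range]
  simp only [mulVec_mulVec, Matrix.mul_assoc]

end MatrixParrott

end LFT

namespace LFT

open Matrix

/-! ### Completion of `X` and `Y` to an invertible scaling. -/

section Completion

variable {𝕜 : Type*} [RCLike 𝕜]

/-- A positive semidefinite matrix is a Gram matrix with as many rows as its rank allows. -/
theorem exists_gram_of_rank_le {ι ρ : Type*} [Fintype ι] [DecidableEq ι] [Fintype ρ]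
    [DecidableEq ρ] {A : Matrix ι ι 𝕜} (hA : A.PosSemidef) (hrank : A.rank ≤ Fintype.card ρ) :
    ∃ H : Matrix ρ ι 𝕜, A = Hᴴ * H := by
  classical
  set ev := hA.isHermitian.eigenvalues with hev
  rw [hA.isHermitian.rank_eq_card_non_zero_eigs] at hrank
  obtain ⟨f⟩ := Function.Embedding.nonempty_of_card_le hrank
  -- Each nonzero eigenvalue gets a row of its own, so `W` is a square root of the diagonal form
  -- with only `card ρ` rows.
  let g : ι → Option ρ := fun i => if h : ev i ≠ 0 then some (f ⟨i, h⟩) else none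
  let W : Matrix ρ ι 𝕜 := of fun a i => if g i = some a then ((√(ev i) : ℝ) : 𝕜) else 0
  have hW : Wᴴ * W = diagonal (RCLike.ofReal ∘ ev) := by
    ext i j
    simp only [mul_apply, conjTranspose_apply, W, of_apply]
    by_cases hi : ev i = 0
    · have : ∀ a, g i ≠ some a := by simp [g, hi]
      by_cases hij : i = j
      · subst hij; simp [this, hi]
      · simp [this, hij]
    · have hgi : g i = some (f ⟨i, hi⟩) := by simp [g, hi]
      rw [Finset.sum_eq_single (f ⟨i, hi⟩)]
      · by_cases hij : i = j
        · subst hij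
          simp only [hgi, if_true, diagonal_apply_eq, Function.comp_apply, RCLike.star_def,
            RCLike.conj_ofReal]
          rw [← RCLike.ofReal_mul, Real.mul_self_sqrt (hA.eigenvalues_nonneg i)]
        · have : g j ≠ some (f ⟨i, hi⟩) := by
            intro h
            by_cases hj : ev j = 0
            · simp [g, hj] at h
            · have h' : f ⟨j, hj⟩ = f ⟨i, hi⟩ := by simpa [g, hj] using h
              exact hij (congrArg Subtype.val (f.injective h')).symm
          simp [this, hij]
      · intro a _ ha
        have : g i ≠ some a := by
          rw [hgi]; simpa using ha.symm
        simp [this]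
      · simp
  refine ⟨W * (hA.isHermitian.eigenvectorUnitary : Matrix ι ι 𝕜)ᴴ, ?_⟩
  conv_lhs => rw [hA.isHermitian.spectral_theorem, Unitary.conjStarAlgAut_apply]
  rw [conjTranspose_mul, conjTranspose_conjTranspose, Matrix.mul_assoc _ Wᴴ,
    ← Matrix.mul_assoc Wᴴ, hW, ← Matrix.mul_assoc]
  rfl

variable {α β : Type*} [Fintype α] [Fintype β]

theorem toBlocks₁₁_conjTranspose_mul (S T : Matrix (α ⊕ β) (α ⊕ β) 𝕜) :
    (Sᴴ * T).toBlocks₁₁ = (S.submatrix id Sum.inl)ᴴ * T.submatrix id Sum.inl := rfl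

variable [DecidableEq α] [DecidableEq β]

/-- The coupling condition on `X` and `Y` as a matrix completion statement. -/
theorem coupling_iff_exists_completion (X Y : Matrix α α 𝕜) :
    ((fromBlocks X 1 1 Y).PosSemidef ∧
        (fromBlocks X 1 1 Y).rank ≤ Fintype.card α + Fintype.card β) ↔
      ∃ R S : Matrix (α ⊕ β) (α ⊕ β) 𝕜,
        R * S = 1 ∧ X = (Sᴴ * S).toBlocks₁₁ ∧ Y = (R * Rᴴ).toBlocks₁₁ := by
  rw [← Fintype.card_sum]
  constructor
  · rintro ⟨hpsd, hrank⟩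
    obtain ⟨H, hH⟩ := exists_gram_of_rank_le hpsd hrank
    set H₁ := H.submatrix id Sum.inl with hH₁
    set H₂ := H.submatrix id Sum.inr with hH₂
    have hX : X = H₁ᴴ * H₁ := 
      (toBlocks_fromBlocks₁₁ X 1 1 Y).symm.trans (congrArg toBlocks₁₁ hH)
    have hY : Y = H₂ᴴ * H₂ := 
      (toBlocks_fromBlocks₂₂ X 1 1 Y).symm.trans (congrArg toBlocks₂₂ hH)
    have h21 : H₂ᴴ * H₁ = 1 := 
      (congrArg toBlocks₂₁ hH).symm.trans (toBlocks_fromBlocks₂₁ X 1 1 Y)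
    -- `H₂ᴴ` has the right inverse `H₁`, so it is onto and its kernel has dimension `card β`: just
    -- enough columns `Z` to complete `H₁` to a square matrix.
    have hfin : Module.finrank 𝕜 (β → 𝕜) =
        Module.finrank 𝕜 (LinearMap.ker (H₂ᴴ).mulVecLin) := by
      have h1 := (H₂ᴴ).mulVecLin.finrank_range_add_finrank_ker
      have h2 : LinearMap.range (H₂ᴴ).mulVecLin = ⊤ := by
        rw [LinearMap.range_eq_top]
        intro y
        exact ⟨H₁ *ᵥ y, by simp [mulVec_mulVec, h21]⟩
      rw [h2, finrank_top] at h1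
      simp only [Module.finrank_fintype_fun_eq_card, Fintype.card_sum] at h1 ⊢
      omega
    let e : (β → 𝕜) ≃ₗ[𝕜] LinearMap.ker (H₂ᴴ).mulVecLin := LinearEquiv.ofFinrankEq _ _ hfin
    let Z : Matrix (α ⊕ β) β 𝕜 :=
      LinearMap.toMatrix' ((LinearMap.ker (H₂ᴴ).mulVecLin).subtype ∘ₗ e.toLinearMap)
    have hZ : ∀ v, Z *ᵥ v = e v := by
      intro v
      rw [← toLin'_apply, toLin'_toMatrix']
      rfl
    have h2Z' : ∀ v, H₂ᴴ *ᵥ (Z *ᵥ v) = 0 := by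
      intro v
      rw [hZ]
      exact LinearMap.mem_ker.mp (e v).2
    have h2Z : H₂ᴴ * Z = 0 := by
      refine ext_of_mulVec_single fun i => ?_
      rw [← mulVec_mulVec, h2Z', zero_mulVec]
    let S : Matrix (α ⊕ β) (α ⊕ β) 𝕜 := fromCols H₁ Z
    have hS : IsUnit S := by
      rw [← mulVec_injective_iff_isUnit]
      refine (injective_iff_map_eq_zero S.mulVecLin).mpr fun v hv => ?_
      have hv' : H₁ *ᵥ (v ∘ Sum.inl) + Z *ᵥ (v ∘ Sum.inr) = 0 := by
        rw [← fromCols_mulVec]; exact hv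
      have h1 : v ∘ Sum.inl = 0 := by
        have := congrArg (fun w => H₂ᴴ *ᵥ w) hv'
        simpa [mulVec_add, h2Z', h21, mulVec_mulVec, h2Z] using this
      have h2 : v ∘ Sum.inr = 0 := by
        rw [h1, mulVec_zero, zero_add, hZ] at hv'
        simpa using hv'
      ext (i | i)
      · exact congrFun h1 i
      · exact congrFun h2 i
    have hSS : S * S⁻¹ = 1 := mul_nonsing_inv _ ((isUnit_iff_isUnit_det _).mp hS)
    -- `H₂ᴴ [H₁ Z] = [1 0]` identifies `H₂ᴴ` with the top rows of `S⁻¹`.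
    have hR : H₂ᴴ = S⁻¹.submatrix Sum.inl id := by
      have h1 : H₂ᴴ * S = (fromCols 1 0 : Matrix α (α ⊕ β) 𝕜) := by
        rw [mul_fromCols, h21, h2Z]
      have h2 : H₂ᴴ = (fromCols 1 0 : Matrix α (α ⊕ β) 𝕜) * S⁻¹ := by
        rw [← h1, Matrix.mul_assoc, hSS, Matrix.mul_one]
      rw [h2]
      ext i j
      simp [mul_apply, one_apply]
    refine ⟨S⁻¹, S, mul_eq_one_comm.mp hSS, hX, ?_⟩
    rw [hY]
    conv_lhs => rw [← conjTranspose_conjTranspose H₂, conjTranspose_conjTranspose H₂ᴴ, hR]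
    rfl
  · rintro ⟨R, S, hRS, hX, hY⟩
    set H : Matrix (α ⊕ β) (α ⊕ α) 𝕜 :=
      fromCols (S.submatrix id Sum.inl) (Rᴴ.submatrix id Sum.inl) with hH
    have key : fromBlocks X 1 1 Y = Hᴴ * H := by
      have h12 : Sᴴ * Rᴴ = 1 := by rw [← conjTranspose_mul, hRS, conjTranspose_one]
      rw [hH, conjTranspose_fromCols_eq_fromRows_conjTranspose, fromRows_mul_fromCols,
        ← toBlocks₁₁_conjTranspose_mul, ← toBlocks₁₁_conjTranspose_mul,
        ← toBlocks₁₁_conjTranspose_mul, ← toBlocks₁₁_conjTranspose_mul,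
        conjTranspose_conjTranspose, h12, hRS, ← hX, ← hY, ← fromBlocks_one,
        toBlocks_fromBlocks₁₁]
    rw [key]
    exact ⟨posSemidef_conjTranspose_mul_self H, by
      rw [rank_conjTranspose_mul_self]; exact rank_le_card_height H⟩

end Completion

end LFT

namespace LFT

open Matrix
open scoped Kronecker

/-! ### Commutants of the uncertainty structures. -/

section Structure

variable {𝕜 : Type*} [RCLike 𝕜] {d : ℕ} (m : Fin d → ℕ)

/-- `diag(I_{m₁} ⊗ R₁, …, I_{m_d} ⊗ R_d)` for rectangular blocks with arbitrary index types. -/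
def blockRepeat {α β : Fin d → Type*} (R : ∀ k, Matrix (α k) (β k) 𝕜) :
    Matrix (Σ k, Fin (m k) × α k) (Σ k, Fin (m k) × β k) 𝕜 :=
  blockDiagonal' fun k => (1 : Matrix (Fin (m k)) (Fin (m k)) 𝕜) ⊗ₖ R k

variable {m}

/-- `diag(Δ₁ ⊗ I, …, Δ_d ⊗ I)` with identities of arbitrary index types. -/
def blockUncertainty (α : Fin d → Type*) [∀ k, DecidableEq (α k)]
    (δ : ∀ k, Matrix (Fin (m k)) (Fin (m k)) 𝕜) :
    Matrix (Σ k, Fin (m k) × α k) (Σ k, Fin (m k) × α k) 𝕜 :=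
  blockDiagonal' fun k => δ k ⊗ₖ (1 : Matrix (α k) (α k) 𝕜)

variable {α : Fin d → Type*}

theorem blockRepeat_mul [∀ k, Fintype (α k)] (R S : ∀ k, Matrix (α k) (α k) 𝕜) :
    blockRepeat m R * blockRepeat m S = blockRepeat m fun k => R k * S k := by
  simp only [blockRepeat, ← blockDiagonal'_mul, ← mul_kronecker_mul, Matrix.one_mul]

theorem blockRepeat_one [∀ k, DecidableEq (α k)] :
    blockRepeat m (fun k => (1 : Matrix (α k) (α k) 𝕜)) = 1 := by
  simp only [blockRepeat, one_kronecker_one]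
  exact blockDiagonal'_one

theorem blockRepeat_conjTranspose (R : ∀ k, Matrix (α k) (α k) 𝕜) :
    (blockRepeat m R)ᴴ = blockRepeat m fun k => (R k)ᴴ := by
  simp only [blockRepeat, blockDiagonal'_conjTranspose, conjTranspose_kronecker,
    conjTranspose_one]

theorem blockRepeat_apply_same {β : Fin d → Type*} (R : ∀ k, Matrix (α k) (β k) 𝕜) (k : Fin d)
    (i j : Fin (m k)) (a : α k) (b : β k) :
    blockRepeat m R ⟨k, i, a⟩ ⟨k, j, b⟩ = if i = j then R k a b else 0 := by
  simp [blockRepeat, blockDiagonal'_apply_eq, one_apply]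

theorem blockRepeat_apply_ne {β : Fin d → Type*} (R : ∀ k, Matrix (α k) (β k) 𝕜) {k l : Fin d}
    (h : k ≠ l) (p : Fin (m k) × α k) (q : Fin (m l) × β l) :
    blockRepeat m R ⟨k, p⟩ ⟨l, q⟩ = 0 :=
  blockDiagonal'_apply_ne _ _ _ h

theorem blockRepeat_mul_blockUncertainty [∀ k, Fintype (α k)] [∀ k, DecidableEq (α k)]
    (R : ∀ k, Matrix (α k) (α k) 𝕜) (δ : ∀ k, Matrix (Fin (m k)) (Fin (m k)) 𝕜) :
    blockRepeat m R * blockUncertainty α δ = blockUncertainty α δ * blockRepeat m R := by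
  simp only [blockRepeat, blockUncertainty, ← blockDiagonal'_mul, ← mul_kronecker_mul,
    Matrix.one_mul, Matrix.mul_one]

theorem mul_blockUncertainty_apply {ι : Type*} [∀ k, Fintype (α k)] [∀ k, DecidableEq (α k)]
    (Z : Matrix ι (Σ k, Fin (m k) × α k) 𝕜) (δ : ∀ k, Matrix (Fin (m k)) (Fin (m k)) 𝕜)
    (p : ι) (l : Fin d) (j : Fin (m l)) (b : α l) :
    (Z * blockUncertainty α δ) p ⟨l, j, b⟩ = ∑ j', Z p ⟨l, j', b⟩ * δ l j' j := by
  rw [mul_apply, Fintype.sum_sigma, Finset.sum_eq_single l]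
  · simp [Fintype.sum_prod_type, blockUncertainty, blockDiagonal'_apply_eq, one_apply]
  · intro k _ hk
    refine Finset.sum_eq_zero fun x _ => ?_
    rw [blockUncertainty, blockDiagonal'_apply_ne _ _ _ hk, mul_zero]
  · simp

theorem blockUncertainty_mul_apply {ι : Type*} [∀ k, Fintype (α k)] [∀ k, DecidableEq (α k)]
    (Z : Matrix (Σ k, Fin (m k) × α k) ι 𝕜) (δ : ∀ k, Matrix (Fin (m k)) (Fin (m k)) 𝕜)
    (q : ι) (k : Fin d) (i : Fin (m k)) (a : α k) :
    (blockUncertainty α δ * Z) ⟨k, i, a⟩ q = ∑ i', δ k i i' * Z ⟨k, i', a⟩ q := by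
  rw [mul_apply, Fintype.sum_sigma, Finset.sum_eq_single k]
  · simp [Fintype.sum_prod_type, blockUncertainty, blockDiagonal'_apply_eq, one_apply]
  · intro l _ hl
    refine Finset.sum_eq_zero fun x _ => ?_
    rw [blockUncertainty, blockDiagonal'_apply_ne _ _ _ hl.symm, zero_mul]
  · simp

/-- The commutant of all `diag(Δₖ ⊗ I)` consists of the `diag(I ⊗ Rₖ)`; blocks that do not occur
may be taken to be identities. -/
theorem exists_eq_blockRepeat [∀ k, Fintype (α k)] [∀ k, DecidableEq (α k)]
    {Z : Matrix (Σ k, Fin (m k) × α k) (Σ k, Fin (m k) × α k) 𝕜}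
    (hZ : ∀ δ : (∀ k, Matrix (Fin (m k)) (Fin (m k)) 𝕜),
      Z * blockUncertainty α δ = blockUncertainty α δ * Z) :
    ∃ R : ∀ k, Matrix (α k) (α k) 𝕜, (∀ k, m k = 0 → R k = 1) ∧ Z = blockRepeat m R := by
  have hne : ∀ (k l : Fin d) (i : Fin (m k)) (j : Fin (m l)) (a : α k) (b : α l), k ≠ l →
      Z ⟨k, i, a⟩ ⟨l, j, b⟩ = 0 := by
    intro k l i j a b hkl
    -- The projection onto the `k`-th summand is a test element that separates the summands.
    have h := congrFun (congrFun (hZ (Pi.single k 1)) ⟨k, i, a⟩) ⟨l, j, b⟩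
    rw [mul_blockUncertainty_apply, blockUncertainty_mul_apply, Pi.single_eq_same,
      Pi.single_eq_of_ne hkl.symm] at h
    simpa [one_apply] using h.symm
  have hunit : ∀ (k : Fin d) (i j i₀ : Fin (m k)) (a b : α k),
      Z ⟨k, i, a⟩ ⟨k, j, b⟩ = if i = j then Z ⟨k, i₀, a⟩ ⟨k, i₀, b⟩ else 0 := by
    intro k i j i₀ a b
    -- The matrix unit `E_{j i₀}` moves column block `j` to `i₀` on one side and row block `i₀` to
    -- `j` on the other.
    have h := congrFun (congrFun (hZ (Pi.single k (Matrix.single j i₀ 1))) ⟨k, i, a⟩) ⟨k, i₀, b⟩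
    rw [mul_blockUncertainty_apply, blockUncertainty_mul_apply, Pi.single_eq_same] at h
    simpa [single_apply, eq_comm, ite_and] using h
  refine ⟨fun k => if h : 0 < m k then of fun a b => Z ⟨k, ⟨0, h⟩, a⟩ ⟨k, ⟨0, h⟩, b⟩ else 1,
    fun k hk => by simp [hk], ?_⟩
  ext ⟨k, i, a⟩ ⟨l, j, b⟩
  by_cases hkl : k = l
  · subst hkl
    have h0 : 0 < m k := i.pos
    rw [blockRepeat_apply_same]
    simp only [h0, dif_pos, of_apply]
    exact hunit k i j ⟨0, h0⟩ a b
  · rw [hne _ _ _ _ _ _ hkl, blockRepeat_apply_ne _ hkl]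

variable (m) in
/-- Regrouping of plant and controller states: the `k`-th summands of both are put together. -/
def regroup (n nK : Fin d → ℕ) :
    StateIdx m n ⊕ StateIdx m nK ≃ Σ k, Fin (m k) × (Fin (n k) ⊕ Fin (nK k)) :=
  (Equiv.sigmaSumDistrib _ _).symm.trans
    (Equiv.sigmaCongrRight fun _ => (Equiv.prodSumDistrib _ _ _).symm)

variable {n nK : Fin d → ℕ}

theorem regroup_inl (k : Fin d) (i : Fin (m k)) (a : Fin (n k)) :
    regroup m n nK (Sum.inl ⟨k, i, a⟩) = ⟨k, i, Sum.inl a⟩ := rfl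

theorem regroup_inr (k : Fin d) (i : Fin (m k)) (a : Fin (nK k)) :
    regroup m n nK (Sum.inr ⟨k, i, a⟩) = ⟨k, i, Sum.inr a⟩ := rfl

/-- Since both groups share the same `Δ⁰ₖ`, the coupled structure is again of the uncoupled kind,
with multiplicity `nₖ + n_{Kk}`. -/
theorem fromBlocks_uncertainty (δ : ∀ k, Matrix (Fin (m k)) (Fin (m k)) 𝕜) :
    fromBlocks (uncertainty n δ) 0 0 (uncertainty nK δ)
      = (blockUncertainty (fun k => Fin (n k) ⊕ Fin (nK k)) δ).submatrix (regroup m n nK)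
        (regroup m n nK) := by
  ext (⟨k, i, a⟩ | ⟨k, i, a⟩) (⟨l, j, b⟩ | ⟨l, j, b⟩) <;>
  by_cases hkl : k = l
  all_goals first
    | subst hkl
      simp [regroup_inl, regroup_inr, uncertainty, blockUncertainty, blockDiagonal'_apply_eq,
        one_apply]
    | simp [regroup_inl, regroup_inr, uncertainty, blockUncertainty,
        blockDiagonal'_apply_ne _ _ _ hkl]

theorem exists_eq_submatrix_blockRepeat
    {Q : Matrix (StateIdx m n ⊕ StateIdx m nK) (StateIdx m n ⊕ StateIdx m nK) 𝕜}
    (hQ : Q ∈ commutant (closedLoopStructure 𝕜 m n nK)) :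
    ∃ R : ∀ k, Matrix (Fin (n k) ⊕ Fin (nK k)) (Fin (n k) ⊕ Fin (nK k)) 𝕜,
      (∀ k, m k = 0 → R k = 1) ∧
        Q = (blockRepeat m R).submatrix (regroup m n nK) (regroup m n nK) := by
  obtain ⟨R, hR1, hR⟩ := exists_eq_blockRepeat
    (Z := Q.submatrix (regroup m n nK).symm (regroup m n nK).symm) fun δ => by
      have h := hQ _ ⟨δ, rfl⟩
      dsimp only at h
      rw [fromBlocks_uncertainty] at h
      have h' := congrArg
        (fun M => M.submatrix (regroup m n nK).symm (regroup m n nK).symm) h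
      simpa [← submatrix_mul_equiv _ _ _ (regroup m n nK).symm, submatrix_submatrix] using h'
  refine ⟨R, hR1, ?_⟩
  rw [← hR]
  simp [submatrix_submatrix]

theorem submatrix_blockRepeat_mem_commutant
    (R : ∀ k, Matrix (Fin (n k) ⊕ Fin (nK k)) (Fin (n k) ⊕ Fin (nK k)) 𝕜) :
    (blockRepeat m R).submatrix (regroup m n nK) (regroup m n nK) ∈
      commutant (closedLoopStructure 𝕜 m n nK) := by
  rintro _ ⟨δ, rfl⟩
  dsimp only
  rw [fromBlocks_uncertainty, submatrix_mul_equiv, submatrix_mul_equiv,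
    blockRepeat_mul_blockUncertainty]

theorem toBlocks₁₁_submatrix_blockRepeat
    (R : ∀ k, Matrix (Fin (n k) ⊕ Fin (nK k)) (Fin (n k) ⊕ Fin (nK k)) 𝕜) :
    ((blockRepeat m R).submatrix (regroup m n nK) (regroup m n nK)).toBlocks₁₁
      = repeatedBlocks m fun k => (R k).toBlocks₁₁ := by
  change _ = blockRepeat m fun k => (R k).toBlocks₁₁
  ext ⟨k, i, a⟩ ⟨l, j, b⟩
  by_cases hkl : k = l
  · subst hkl
    simp [toBlocks₁₁, regroup_inl, blockRepeat_apply_same]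
  · simp [toBlocks₁₁, regroup_inl, blockRepeat_apply_ne _ hkl]

theorem repeatedBlocks_mem_commutant (X₀ : ∀ k, Matrix (Fin (n k)) (Fin (n k)) 𝕜) :
    repeatedBlocks m X₀ ∈ commutant (openStructure 𝕜 m n) := by
  rintro _ ⟨δ, rfl⟩
  exact blockRepeat_mul_blockUncertainty X₀ δ

end Structure

end LFT

namespace LFT

open Matrix

/-! ### Well-posedness and removal of the feedthrough. -/

section WellPosedness

variable {𝕜 : Type*} [RCLike 𝕜]

/-- The determinant is a polynomial in `t` with value `1` at `t = 0`, so it is not the zero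
polynomial. -/
theorem finite_setOf_det_one_add_smul_eq_zero {ι : Type*} [Fintype ι] [DecidableEq ι]
    (M : Matrix ι ι 𝕜) : {t : 𝕜 | (1 + t • M).det = 0}.Finite := by
  let p : Polynomial 𝕜 := (1 + (Polynomial.X : Polynomial 𝕜) • M.map Polynomial.C).det
  have hp : ∀ t, p.eval t = (1 + t • M).det := by
    intro t
    change Polynomial.evalRingHom t p = _
    rw [RingHom.map_det]
    congr 1
    ext i j
    by_cases hij : i = j <;> simp [hij] <;> exact mul_comm _ _
  have hp0 : p ≠ 0 := by
    intro h
    have := hp 0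
    rw [h, Polynomial.eval_zero, zero_smul, add_zero, det_one] at this
    exact zero_ne_one this
  refine (Polynomial.finite_setOfPred_isRoot hp0).subset fun t ht => ?_
  simpa [Polynomial.IsRoot, hp] using ht

theorem exists_lt_one_and_isUnit_one_add_smul {ι : Type*} [Fintype ι] [DecidableEq ι]
    (M : Matrix ι ι 𝕜) {f : 𝕜 → ℝ} (hf : Continuous f) (h1 : f 1 < 1) :
    ∃ t, f t < 1 ∧ IsUnit (1 + t • M) := by
  have hdense := (finite_setOf_det_one_add_smul_eq_zero M).countable.dense_compl 𝕜
  obtain ⟨t, ht, ht'⟩ := hdense.inter_open_nonempty _ (isOpen_lt hf continuous_const) ⟨1, h1⟩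
  exact ⟨t, ht, (isUnit_iff_isUnit_det _).mpr (isUnit_iff_ne_zero.mpr ht')⟩

/-- The matrix is block lower triangular with an identity in the controller-state corner. -/
theorem isUnit_one_add_feedthrough_iff {β γ κ : Type*} [Fintype β] [DecidableEq β] [Fintype γ]
    [DecidableEq γ] [Fintype κ] [DecidableEq κ] (D : Matrix κ γ 𝕜)
    (K : Matrix (β ⊕ γ) (β ⊕ κ) 𝕜) :
    IsUnit (1 + (fromBlocks 0 0 0 D : Matrix (β ⊕ κ) (β ⊕ γ) 𝕜) * K) ↔ IsUnit (1 + D * K.toBlocks₂₂) := by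
  have : 1 + (fromBlocks 0 0 0 D : Matrix (β ⊕ κ) (β ⊕ γ) 𝕜) * K
      = fromBlocks 1 0 (D * K.toBlocks₂₁) (1 + D * K.toBlocks₂₂) := by
    conv_lhs => rw [← fromBlocks_toBlocks K, fromBlocks_multiply, ← fromBlocks_one,
      fromBlocks_add]
    simp
  rw [this, isUnit_fromBlocks_zero₁₂]
  simp

/-- Removing the feedthrough term from a feedback loop by redefining the controller. -/
theorem exists_loop_transform {ι κ : Type*} [Fintype ι] [DecidableEq ι] [Fintype κ]
    [DecidableEq κ] (D : Matrix κ ι 𝕜) (K₀ : Matrix ι κ 𝕜) (h : IsUnit (1 + D * K₀)) :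
    ∃ K : Matrix ι κ 𝕜, IsUnit (1 - D * K) ∧ (1 - K * D)⁻¹ * K = K₀ := by
  have hinv : (1 + D * K₀)⁻¹ * (1 + D * K₀) = 1 :=
    nonsing_inv_mul _ ((isUnit_iff_isUnit_det _).mp h)
  refine ⟨K₀ * (1 + D * K₀)⁻¹, ?_⟩
  set K := K₀ * (1 + D * K₀)⁻¹ with hK
  have hK0 : K + K * D * K₀ = K₀ := by
    have : K * (1 + D * K₀) = K₀ := by rw [hK, Matrix.mul_assoc, hinv, Matrix.mul_one]
    rwa [Matrix.mul_add, Matrix.mul_one, ← Matrix.mul_assoc] at this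
  have h1 : (1 - D * K) * (1 + D * K₀) = 1 := by
    calc (1 - D * K) * (1 + D * K₀) = 1 + D * K₀ - D * (K + K * D * K₀) := by
          simp only [Matrix.sub_mul, Matrix.mul_add, Matrix.mul_one, Matrix.one_mul,
            Matrix.mul_assoc]
          abel
      _ = 1 := by rw [hK0, add_sub_cancel_right]
  have h2 : (1 - K * D) * (1 + K₀ * D) = 1 := by
    calc (1 - K * D) * (1 + K₀ * D) = 1 + K₀ * D - (K + K * D * K₀) * D := by
          simp only [Matrix.sub_mul, Matrix.mul_add, Matrix.add_mul, Matrix.mul_one,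
            Matrix.one_mul, Matrix.mul_assoc]
          abel
      _ = 1 := by rw [hK0, add_sub_cancel_right]
  have h3 : (1 - K * D) * K₀ = K := by
    rw [Matrix.sub_mul, Matrix.one_mul, sub_eq_iff_eq_add]
    exact hK0.symm
  refine ⟨isUnit_iff_exists_inv.mpr ⟨_, h1⟩, ?_⟩
  have h4 : (1 - K * D)⁻¹ * (1 - K * D) = 1 :=
    nonsing_inv_mul _ ((isUnit_iff_isUnit_det _).mp (isUnit_iff_exists_inv.mpr ⟨_, h2⟩))
  calc (1 - K * D)⁻¹ * K = (1 - K * D)⁻¹ * ((1 - K * D) * K₀) := by rw [h3]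
    _ = K₀ := by rw [← Matrix.mul_assoc, h4, Matrix.one_mul]

variable {d : ℕ} {m n nK : Fin d → ℕ} {r₁ r₂ s₁ s₂ : ℕ}

/-- Only associativity is involved, so the identity holds whatever value `⁻¹` takes. -/
theorem closedLoopA_eq (P : Plant 𝕜 m n r₁ r₂ s₁ s₂) (K : Controller 𝕜 m nK r₂ s₂) :
    closedLoopA P K = feedback P.A P.B₂ P.C₂
      ((1 - fromBlocks K.A K.B K.C K.D *
          (fromBlocks 0 0 0 P.D₂₂ : Matrix (StateIdx m nK ⊕ _) (StateIdx m nK ⊕ _) 𝕜))⁻¹ *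
        fromBlocks K.A K.B K.C K.D) := by
  rw [feedback, ← Matrix.mul_assoc]
  rfl

theorem exists_controller (P : Plant 𝕜 m n r₁ r₂ s₁ s₂)
    (K₀ : Matrix (StateIdx m nK ⊕ Fin r₂) (StateIdx m nK ⊕ Fin s₂) 𝕜)
    (h : IsUnit (1 + P.D₂₂ * K₀.toBlocks₂₂)) :
    ∃ K : Controller 𝕜 m nK r₂ s₂, WellPosed P K ∧
      closedLoopA P K = feedback P.A P.B₂ P.C₂ K₀ := by
  obtain ⟨K, hK1, hK2⟩ :=
    exists_loop_transform (fromBlocks 0 0 0 P.D₂₂) K₀ ((isUnit_one_add_feedthrough_iff _ _).mpr h)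
  refine ⟨⟨K.toBlocks₁₁, K.toBlocks₁₂, K.toBlocks₂₁, K.toBlocks₂₂⟩, ?_, ?_⟩
  -- The sign change turns `1 + D K` into the `1 - D K` of well-posedness.
  · have := isUnit_one_add_feedthrough_iff P.D₂₂ (-K)
    rw [Matrix.mul_neg, ← sub_eq_add_neg] at this
    have h' := this.mp hK1
    rwa [show (-K).toBlocks₂₂ = -K.toBlocks₂₂ from rfl, Matrix.mul_neg, ← sub_eq_add_neg] at h'
  · rw [closedLoopA_eq]
    simp only [fromBlocks_toBlocks, hK2]

/-- The matrix inside the norm is affine in `t`. -/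
theorem continuous_norm_feedback {α β γ κ : Type*} [Fintype α] [DecidableEq α] [Fintype β]
    [DecidableEq β] [Fintype γ] [Fintype κ] (A : Matrix α α 𝕜) (B : Matrix α γ 𝕜)
    (C : Matrix κ α 𝕜) (K : Matrix (β ⊕ γ) (β ⊕ κ) 𝕜) (R S : Matrix (α ⊕ β) (α ⊕ β) 𝕜) :
    Continuous fun t : 𝕜 =>
      ‖toEuclideanCLM (n := α ⊕ β) (𝕜 := 𝕜) (S * feedback A B C (t • K) * R)‖ := by
  have h : ∀ t : 𝕜, S * feedback A B C (t • K) * R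
      = S * feedback A B C 0 * R
        + t • (S * (feedback A B C K - feedback A B C 0) * R) := by
    intro t
    simp only [feedback, Matrix.mul_add, Matrix.add_mul, Matrix.mul_smul, Matrix.smul_mul,
      Matrix.mul_zero, Matrix.zero_mul, add_zero, add_sub_cancel_left]
  simp only [h, map_add, map_smul]
  fun_prop

/-- Well-posedness costs nothing: a strict scaled bound survives a small change of the gain. -/
theorem exists_wellPosed_iff (P : Plant 𝕜 m n r₁ r₂ s₁ s₂)
    (R S : Matrix (StateIdx m n ⊕ StateIdx m nK) (StateIdx m n ⊕ StateIdx m nK) 𝕜) :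
    (∃ K : Controller 𝕜 m nK r₂ s₂, WellPosed P K ∧
      ‖toEuclideanCLM (n := StateIdx m n ⊕ StateIdx m nK) (𝕜 := 𝕜) (S * closedLoopA P K * R)‖ < 1) ↔
    ∃ K₀ : Matrix (StateIdx m nK ⊕ Fin r₂) (StateIdx m nK ⊕ Fin s₂) 𝕜,
      ‖toEuclideanCLM (n := StateIdx m n ⊕ StateIdx m nK) (𝕜 := 𝕜)
        (S * feedback P.A P.B₂ P.C₂ K₀ * R)‖ < 1 := by
  constructor
  · rintro ⟨K, -, hK⟩
    rw [closedLoopA_eq] at hK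
    exact ⟨_, hK⟩
  · rintro ⟨K₀, hK₀⟩
    obtain ⟨t, ht, hunit⟩ := exists_lt_one_and_isUnit_one_add_smul (P.D₂₂ * K₀.toBlocks₂₂)
      (continuous_norm_feedback P.A P.B₂ P.C₂ K₀ R S) (by simpa only [one_smul] using hK₀)
    obtain ⟨K, hK1, hK2⟩ := exists_controller P (t • K₀) (by
      rwa [show (t • K₀).toBlocks₂₂ = t • K₀.toBlocks₂₂ from rfl, Matrix.mul_smul])
    exact ⟨K, hK1, by rw [hK2]; exact ht⟩

end WellPosedness

end LFT

/-! ### Assembly of the equivalence. -/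

theorem theorem3p1 {𝕜 : Type*} [RCLike 𝕜] {d : ℕ} (m n nK : Fin d → ℕ) {r₁ r₂ s₁ s₂ : ℕ}
    (P : LFT.Plant 𝕜 m n r₁ r₂ s₁ s₂)
    {p q : ℕ} (Bperp : Matrix (LFT.StateIdx m n) (Fin p) 𝕜)
    (Cperp : Matrix (Fin q) (LFT.StateIdx m n) 𝕜)
    (hB_inj : Function.Injective Bperp.mulVecLin)
    (hB_range : LinearMap.range Bperp.mulVecLin = LinearMap.ker P.B₂.conjTranspose.mulVecLin)
    (hC_inj : Function.Injective Cperp.conjTranspose.mulVecLin)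
    (hC_range : LinearMap.range Cperp.conjTranspose.mulVecLin = LinearMap.ker P.C₂.mulVecLin) :
    (∃ K : LFT.Controller 𝕜 m nK r₂ s₂, LFT.WellPosed P K ∧ LFT.ClosedLoopQStable P K) ↔
      ∃ X ∈ LFT.commutant (LFT.openStructure 𝕜 m n),
      ∃ Y ∈ LFT.commutant (LFT.openStructure 𝕜 m n),
        X.PosDef ∧ Y.PosDef ∧
        (-(Bperp.conjTranspose * P.A * Y * P.A.conjTranspose * Bperp
            - Bperp.conjTranspose * Y * Bperp)).PosDef ∧
        (-(Cperp * P.A.conjTranspose * X * P.A * Cperp.conjTranspose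
            - Cperp * X * Cperp.conjTranspose)).PosDef ∧
        ∃ X₀ Y₀ : ∀ k : Fin d, Matrix (Fin (n k)) (Fin (n k)) 𝕜,
          X = LFT.repeatedBlocks m X₀ ∧ Y = LFT.repeatedBlocks m Y₀ ∧
          ∀ k : Fin d,
            (Matrix.fromBlocks (X₀ k) 1 1 (Y₀ k)).PosSemidef ∧
            (Matrix.fromBlocks (X₀ k) 1 1 (Y₀ k)).rank ≤ n k + nK k := by
  let e := LFT.regroup m n nK
  have coupling := fun k => LFT.coupling_iff_exists_completion (𝕜 := 𝕜) (α := Fin (n k))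
    (β := Fin (nK k))
  simp only [Fintype.card_fin] at coupling
  have blocks_mul : ∀ R S : (∀ k, Matrix (Fin (n k) ⊕ Fin (nK k)) (Fin (n k) ⊕ Fin (nK k)) 𝕜),
      (LFT.blockRepeat m R).submatrix e e * (LFT.blockRepeat m S).submatrix e e
        = (LFT.blockRepeat m fun k => R k * S k).submatrix e e := fun R S => by
    rw [Matrix.submatrix_mul_equiv, LFT.blockRepeat_mul]
  have blocks_star : ∀ R : (∀ k, Matrix (Fin (n k) ⊕ Fin (nK k)) (Fin (n k) ⊕ Fin (nK k)) 𝕜),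
      ((LFT.blockRepeat m R).submatrix e e).conjTranspose
        = (LFT.blockRepeat m fun k => (R k).conjTranspose).submatrix e e := fun R => by
    rw [Matrix.conjTranspose_submatrix, LFT.blockRepeat_conjTranspose]
  constructor
  · rintro ⟨K, hK, Q, hQ, hQu, hQK⟩
    have hdet := (Matrix.isUnit_iff_isUnit_det _).mp hQu
    have hQQ : Q * Q⁻¹ = 1 := Matrix.mul_nonsing_inv _ hdet
    have hQQ' : Q⁻¹ * Q = 1 := Matrix.nonsing_inv_mul _ hdet
    have hQ' : Q⁻¹ ∈ LFT.commutant (LFT.closedLoopStructure 𝕜 m n nK) := by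
      intro D hD
      calc Q⁻¹ * D = Q⁻¹ * (D * Q) * Q⁻¹ := by
            rw [Matrix.mul_assoc, Matrix.mul_assoc D, hQQ, Matrix.mul_one]
        _ = D * Q⁻¹ := by
            rw [← hQ D hD, ← Matrix.mul_assoc, hQQ', Matrix.one_mul]
    obtain ⟨R, hR1, hR⟩ := LFT.exists_eq_submatrix_blockRepeat hQ
    obtain ⟨S, hS1, hS⟩ := LFT.exists_eq_submatrix_blockRepeat hQ'
    have hRS : ∀ k, R k * S k = 1 := by
      intro k
      -- For `m k = 0` the matrix `Q` carries no information about block `k`, yet the coupling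
      -- condition is still demanded there; the default `R k = S k = 1` supplies it.
      rcases Nat.eq_zero_or_pos (m k) with h0 | h0
      · rw [hR1 k h0, hS1 k h0, Matrix.one_mul]
      · have h1 : (LFT.blockRepeat m fun k => R k * S k) = 1 := by
          have : (LFT.blockRepeat m fun k => R k * S k).submatrix e e = 1 := by
            rw [← blocks_mul, ← hR, ← hS, hQQ]
          have h := congrArg (fun M => M.submatrix e.symm e.symm) this
          simpa [Matrix.submatrix_submatrix] using h
        ext a b
        have h2 := congrFun (congrFun h1 ⟨k, ⟨0, h0⟩, a⟩) ⟨k, ⟨0, h0⟩, b⟩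
        rw [← LFT.blockRepeat_one, LFT.blockRepeat_apply_same, LFT.blockRepeat_apply_same] at h2
        simpa using h2
    have hX : LFT.repeatedBlocks m (fun k => ((S k).conjTranspose * S k).toBlocks₁₁)
        = ((Q⁻¹).conjTranspose * Q⁻¹).toBlocks₁₁ := by
      rw [hS, blocks_star, blocks_mul, LFT.toBlocks₁₁_submatrix_blockRepeat]
    have hY : LFT.repeatedBlocks m (fun k => (R k * (R k).conjTranspose).toBlocks₁₁)
        = (Q * Q.conjTranspose).toBlocks₁₁ := by
      conv_rhs => rw [hR, blocks_star, blocks_mul, LFT.toBlocks₁₁_submatrix_blockRepeat]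
    have lmi := (LFT.exists_feedback_iff_lmi P.A P.B₂ P.C₂ Bperp Cperp hB_inj hB_range hC_inj
      hC_range hQQ hX hY).mp ((LFT.exists_wellPosed_iff P Q Q⁻¹).mp ⟨K, hK, hQK⟩)
    refine ⟨_, LFT.repeatedBlocks_mem_commutant _, _, LFT.repeatedBlocks_mem_commutant _, ?_, ?_,
      lmi.1, lmi.2, _, _, rfl, rfl, fun k => (coupling k _ _).mpr ⟨R k, S k, hRS k, rfl, rfl⟩⟩
    · rw [hX]
      have hinj := Matrix.mulVec_injective_iff_isUnit.mpr (isUnit_iff_exists_inv.mpr ⟨Q, hQQ'⟩)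
      exact (Matrix.PosDef.conjTranspose_mul_self _ hinj).submatrix Sum.inl_injective
    · rw [hY]
      have hinj := Matrix.vecMul_injective_iff_isUnit.mpr hQu
      exact (Matrix.PosDef.mul_conjTranspose_self _ hinj).submatrix Sum.inl_injective
  · rintro ⟨X, -, Y, -, -, -, lmiB, lmiC, X₀, Y₀, rfl, rfl, hXY⟩
    choose R S hRS hX hY using fun k => (coupling k _ _).mp (hXY k)
    set Q := (LFT.blockRepeat m R).submatrix e e with hQ
    set T := (LFT.blockRepeat m S).submatrix e e with hT
    have hQT : Q * T = 1 := by
      rw [hQ, hT, blocks_mul]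
      simp only [hRS]
      rw [LFT.blockRepeat_one, Matrix.submatrix_one_equiv]
    have hX' : LFT.repeatedBlocks m X₀ = (T.conjTranspose * T).toBlocks₁₁ := by
      rw [hT, blocks_star, blocks_mul, LFT.toBlocks₁₁_submatrix_blockRepeat, funext hX]
    have hY' : LFT.repeatedBlocks m Y₀ = (Q * Q.conjTranspose).toBlocks₁₁ := by
      rw [hQ, blocks_star, blocks_mul, LFT.toBlocks₁₁_submatrix_blockRepeat, funext hY]
    obtain ⟨K, hK1, hK2⟩ := (LFT.exists_wellPosed_iff P Q T).mpr
      ((LFT.exists_feedback_iff_lmi P.A P.B₂ P.C₂ Bperp Cperp hB_inj hB_range hC_inj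
        hC_range hQT hX' hY').mpr ⟨lmiB, lmiC⟩)
    refine ⟨K, hK1, Q, LFT.submatrix_blockRepeat_mem_commutant R,
      isUnit_iff_exists_inv.mpr ⟨T, hQT⟩, ?_⟩
    rwa [Matrix.inv_eq_right_inv hQT]
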